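/- Let $M,N$ be natural numbers, let $\mathbb K$ be $\mathbb R$ or $\mathbb C$, and let $\mathbb M_{M,N}$ be the space of $M\times N$ matrices over $\mathbb K$ with the Frobenius inner product $\langle\cdot,\cdot\rangle$ and the Frobenius norm $\|\cdot\|$. Let $\mathcal H\subset\mathbb M_{M,N}$ be a linear subspace, let $\mathcal P_{\mathcal H}$ and $\mathcal P_{\mathcal H^\perp}$ be the orthogonal projections onto $\mathcal H$ and $\mathcal H^\perp$, let $F\in\mathcal H$, let $\tau>0$, and let $1<p,q<\infty$ satisfy $1/p+1/q=1$. For $f:[0,\infty)\to\mathbb R$ with $f(0)=0$ and a matrix $A$ with singular value decomposition $A=U\,\mathrm{diag}(\sigma_j(A))\,V^*$, put $\mathfrak S_f(A)=U\,\mathrm{diag}(f(\sigma_j(A)))\,V^*$. Let $s_{\tau,q}(\sigma)=\max(\min(\sigma,\tau),\sigma/q)$ and $$\mathfrak B_{F,\tau,q}(W)=\mathfrak S_{s_{\tau,q}}\bigl(qF+\mathcal P_{\mathcal H^\perp}W\bigr),\qquad W\in\mathbb M_{M,N}.$$ Let $$\mathscr K(A,B)=\tau^2\,\mathrm{rank}(A)+p\|A-B\|^2+q\|B-F\|^2,$$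 and let $$\mathscr K^*(X,Y)=\sup_{A,B\in\mathbb M_{M,N}}\bigl(\mathrm{Re}\langle A,X\rangle+\mathrm{Re}\langle B,Y\rangle-\mathscr K(A,B)\bigr)$$ be its Fenchel conjugate. **Theorem 4.2.** There exists a fixed point $W^\circ$ of $\mathfrak B_{F,\tau,q}$ such that the pair $$X^\circ=2p\bigl(\mathcal P_{\mathcal H}W^\circ-F\bigr)+2\mathcal P_{\mathcal H^\perp}W^\circ,\qquad Y^\circ=-2p\bigl(\mathcal P_{\mathcal H}W^\circ-F\bigr)$$ solves the problem of minimizing $\mathscr K^*(X,Y)$ over all $X,Y\in\mathbb M_{M,N}$ with $X+Y\in\mathcal H^\perp$; that is, $X^\circ+Y^\circ\in\mathcal H^\perp$ and $\mathscr K^*(X^\circ,Y^\circ)\le\mathscr K^*(X,Y)$ for all $X,Y$ with $X+Y\in\mathcal H^\perp$. -/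

import Mathlib

open scoped Matrix

attribute [local instance] Matrix.frobeniusNormedAddCommGroup Matrix.frobeniusNormedSpace

namespace RankPenalty

section Definitions

variable {𝕜 : Type*} [RCLike 𝕜] {M N : ℕ}

/-- The Frobenius inner product `⟪A, B⟫ = ∑ᵢⱼ conj (A i j) * B i j` on the space of `M × N`
matrices, which induces Mathlib's Frobenius norm. -/
noncomputable instance frobeniusInnerProductSpace :
    InnerProductSpace 𝕜 (Matrix (Fin M) (Fin N) 𝕜) where
  inner A B := ∑ i, ∑ j, inner 𝕜 (A i j) (B i j)
  norm_sq_eq_re_inner A := by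
    rw [Matrix.frobenius_norm_def, ← Real.sqrt_eq_rpow, Real.sq_sqrt (by positivity)]
    simp
  conj_inner_symm A B := by
    simp only [map_sum, inner_conj_symm]
  add_left A B C := by
    simp only [Matrix.add_apply, inner_add_left, Finset.sum_add_distrib]
  smul_left A B r := by
    simp only [Matrix.smul_apply, inner_smul_left (𝕜 := 𝕜), Finset.mul_sum]

/-- The rectangular `M × N` matrix with `σ 0, σ 1, …` on its main diagonal and zeros elsewhere. -/
def rectDiag (𝕜 : Type*) [RCLike 𝕜] (M N : ℕ) (σ : ℕ → ℝ) : Matrix (Fin M) (Fin N) 𝕜 :=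
  Matrix.of fun i j => if (i : ℕ) = (j : ℕ) then ((σ i : ℝ) : 𝕜) else 0

/-- `A = U diag(σ) Vᴴ` is a singular value decomposition: `U`, `V` are unitary and the `σ j` are
nonnegative (listed in any order; only the `σ j` with `j < min M N` occur in `A`). -/
structure IsSVD (A : Matrix (Fin M) (Fin N) 𝕜) (U : Matrix (Fin M) (Fin M) 𝕜) (σ : ℕ → ℝ)
    (V : Matrix (Fin N) (Fin N) 𝕜) : Prop where
  left_unitary : U ∈ Matrix.unitaryGroup (Fin M) 𝕜
  right_unitary : V ∈ Matrix.unitaryGroup (Fin N) 𝕜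
  nonneg : ∀ j, 0 ≤ σ j
  eq : A = U * rectDiag 𝕜 M N σ * Vᴴ

/-- Every matrix has a singular value decomposition. -/
theorem exists_isSVD (A : Matrix (Fin M) (Fin N) 𝕜) :
    ∃ D : Matrix (Fin M) (Fin M) 𝕜 × (ℕ → ℝ) × Matrix (Fin N) (Fin N) 𝕜,
      IsSVD A D.1 D.2.1 D.2.2 := by
  classical
  set T := Matrix.toEuclideanLin A with hT
  have hfr : Module.finrank 𝕜 (EuclideanSpace 𝕜 (Fin N)) = N := by simp
  set v := T.isSymmetric_adjoint_comp_self.eigenvectorBasis hfr with hv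
  have hin : ∀ i j : Fin N, inner 𝕜 (T (v i)) (T (v j)) =
      if i = j then ((T.singularValues i ^ 2 : ℝ) : 𝕜) else 0 := by
    intro i j
    rw [← LinearMap.adjoint_inner_right, ← LinearMap.comp_apply, hv,
      LinearMap.IsSymmetric.apply_eigenvectorBasis, inner_smul_right,
      orthonormal_iff_ite.1 (OrthonormalBasis.orthonormal _), T.sq_singularValues_fin hfr]
    split_ifs with h
    · subst h; simp
    · simp
  have hlt : ∀ k : ℕ, 0 < T.singularValues k → k < N ∧ k < M := by
    intro k hk
    rw [LinearMap.singularValues_pos_iff_lt_finrank_range] at hk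
    refine ⟨hk.trans_le ?_, hk.trans_le ?_⟩
    · simpa using LinearMap.finrank_range_le T
    · simpa using Submodule.finrank_le (LinearMap.range T)
  let w : Fin M → EuclideanSpace 𝕜 (Fin M) := fun i =>
    if h : (i : ℕ) < N then ((T.singularValues i)⁻¹ : 𝕜) • T (v ⟨i, h⟩) else 0
  have hw : Orthonormal 𝕜 (Set.domRestrict {i : Fin M | 0 < T.singularValues i} w) := by
    rw [orthonormal_iff_ite]
    rintro ⟨i, hi⟩ ⟨j, hj⟩
    have hi' : 0 < T.singularValues i := hi
    have hj' : 0 < T.singularValues j := hj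
    have e1 : ∀ x (hx : x ∈ {i : Fin M | 0 < T.singularValues i}),
        Set.domRestrict {i : Fin M | 0 < T.singularValues i} w ⟨x, hx⟩ = w x := fun _ _ => rfl
    rw [e1, e1]
    simp only [w, dif_pos (hlt _ hi').1, dif_pos (hlt _ hj').1,
      inner_smul_left, inner_smul_right, hin, Subtype.mk.injEq, Fin.ext_iff]
    split_ifs with h
    · rw [← h]
      have : ((T.singularValues i : ℝ) : 𝕜) ≠ 0 := by exact_mod_cast hi'.ne'
      simp
      field_simp
    · simp
  obtain ⟨b, hb⟩ := hw.exists_orthonormalBasis_extension_of_card_eq (by simp)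
  have hTv : ∀ j : Fin N, 0 < T.singularValues j → ∀ h : (j : ℕ) < M,
      T (v j) = ((T.singularValues j : ℝ) : 𝕜) • b ⟨j, h⟩ := by
    intro j hj h
    have h0 : ((T.singularValues j : ℝ) : 𝕜) ≠ 0 := by exact_mod_cast hj.ne'
    rw [hb ⟨j, h⟩ hj]
    simp [w, smul_smul, h0]
  have hTv0 : ∀ j : Fin N, T.singularValues j = 0 → T (v j) = 0 := by
    intro j hj
    rw [← inner_self_eq_zero (𝕜 := 𝕜), hin, hj]
    simp
  let U := (EuclideanSpace.basisFun (Fin M) 𝕜).toBasis.toMatrix b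
  let V := (EuclideanSpace.basisFun (Fin N) 𝕜).toBasis.toMatrix v
  have hU : U ∈ Matrix.unitaryGroup (Fin M) 𝕜 :=
    OrthonormalBasis.toMatrix_orthonormalBasis_mem_unitary _ _
  have hV : V ∈ Matrix.unitaryGroup (Fin N) 𝕜 :=
    OrthonormalBasis.toMatrix_orthonormalBasis_mem_unitary _ _
  refine ⟨(U, T.singularValues, V), hU, hV, T.singularValues_nonneg, ?_⟩
  have key : A * V = U * rectDiag 𝕜 M N T.singularValues := by
    ext i j
    have h1 : (A * V) i j = T (v j) i := by
      simp [hT, V, Module.Basis.toMatrix_apply, Matrix.mul_apply, Matrix.mulVec, dotProduct]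
    rw [h1, Matrix.mul_apply]
    rcases (T.singularValues_nonneg j).eq_or_lt with h0 | h0
    · rw [hTv0 j h0.symm]
      symm
      simp only [PiLp.zero_apply]
      refine Finset.sum_eq_zero fun k _ => ?_
      simp only [rectDiag, Matrix.of_apply]
      split_ifs with hk
      · rw [hk, ← h0]; simp
      · simp
    · have hjM := (hlt _ h0).2
      rw [hTv j h0 hjM, Finset.sum_eq_single ⟨j, hjM⟩]
      · simp [U, rectDiag, Module.Basis.toMatrix_apply, RCLike.real_smul_eq_coe_mul, mul_comm]
      · intro k _ hk
        have : (k : ℕ) ≠ j := fun h => hk (Fin.ext h)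
        simp [rectDiag, this]
      · simp
  have hVV : V * Vᴴ = 1 := (Matrix.mem_unitaryGroup_iff).1 hV
  show A = U * rectDiag 𝕜 M N T.singularValues * Vᴴ
  rw [← key, Matrix.mul_assoc, hVV, Matrix.mul_one]

/-- The singular value functional calculus: `svCalc f A = U diag(f (σ j)) Vᴴ` where
`A = U diag(σ j) Vᴴ` is a singular value decomposition. -/
noncomputable def svCalc (f : ℝ → ℝ) (A : Matrix (Fin M) (Fin N) 𝕜) :
    Matrix (Fin M) (Fin N) 𝕜 :=
  let D := (exists_isSVD A).choose
  D.1 * rectDiag 𝕜 M N (f ∘ D.2.1) * D.2.2ᴴ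

/-- If `f 0 = 0`, then `svCalc f A` does not depend on the singular value decomposition chosen. -/
theorem svCalc_eq {f : ℝ → ℝ} (hf : f 0 = 0) {A : Matrix (Fin M) (Fin N) 𝕜}
    {U : Matrix (Fin M) (Fin M) 𝕜} {σ : ℕ → ℝ} {V : Matrix (Fin N) (Fin N) 𝕜}
    (h : IsSVD A U σ V) : svCalc f A = U * rectDiag 𝕜 M N (f ∘ σ) * Vᴴ := by
  classical
  obtain ⟨hU', hV', hn', e'⟩ := (exists_isSVD A).choose_spec
  set D := (exists_isSVD A).choose with hD
  obtain ⟨hU, hV, hn, e⟩ := h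
  -- interpolate `x ↦ f (√x) / √x` at the squares of all singular values
  let S : Finset ℝ :=
    (Finset.range M).image (fun j => σ j ^ 2) ∪ (Finset.range M).image (fun j => D.2.1 j ^ 2)
  let P : Polynomial ℝ := Lagrange.interpolate S id (fun x => f (√x) / √x)
  have hP : ∀ x ∈ S, P.eval x = f (√x) / √x := fun x hx =>
    Lagrange.eval_interpolate_at_node (v := id) (fun x => f (√x) / √x)
      (Function.injective_id.injOn) hx
  have hPs : ∀ s : ℝ, 0 ≤ s → s ^ 2 ∈ S → s * P.eval (s ^ 2) = f s := by
    intro s hs hsS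
    rw [hP _ hsS, Real.sqrt_sq hs]
    rcases hs.eq_or_lt with h0 | h0
    · simp [← h0, hf]
    · field_simp
  have main : ∀ (U : Matrix (Fin M) (Fin M) 𝕜) (σ : ℕ → ℝ) (V : Matrix (Fin N) (Fin N) 𝕜),
      U ∈ Matrix.unitaryGroup (Fin M) 𝕜 → V ∈ Matrix.unitaryGroup (Fin N) 𝕜 → (∀ j, 0 ≤ σ j) →
      A = U * rectDiag 𝕜 M N σ * Vᴴ → (∀ j < M, σ j ^ 2 ∈ S) →
      U * rectDiag 𝕜 M N (f ∘ σ) * Vᴴ = A * Polynomial.aeval (Aᴴ * A) P := by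
    intro U σ V hU hV hn e hS
    have hUU : Uᴴ * U = 1 := (Matrix.mem_unitaryGroup_iff').1 hU
    have hVV : Vᴴ * V = 1 := (Matrix.mem_unitaryGroup_iff').1 hV
    have hVV' : V * Vᴴ = 1 := (Matrix.mem_unitaryGroup_iff).1 hV
    let d : Fin N → 𝕜 := fun j => if (j : ℕ) < M then ((σ j ^ 2 : ℝ) : 𝕜) else 0
    have hRR : (rectDiag 𝕜 M N σ)ᴴ * rectDiag 𝕜 M N σ = Matrix.diagonal d := by
      ext i j
      rw [Matrix.mul_apply]
      simp only [rectDiag, Matrix.conjTranspose_apply, Matrix.of_apply, Matrix.diagonal_apply, d]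
      by_cases hi : (i : ℕ) < M
      · rw [Finset.sum_eq_single ⟨i, hi⟩]
        · by_cases hij : i = j
          · subst hij; simp [hi, sq]
          · have : (i : ℕ) ≠ j := fun h => hij (Fin.ext h)
            simp [hij, this]
        · intro k _ hk
          have : (k : ℕ) ≠ i := fun h => hk (Fin.ext h)
          simp [this]
        · simp
      · rw [Finset.sum_eq_zero]
        · simp [hi]
        · intro k _
          have : (k : ℕ) ≠ i := fun h => hi (h ▸ k.2)
          simp [this]
    have hAA : Aᴴ * A = V * Matrix.diagonal d * Vᴴ := by
      rw [← hRR, e]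
      simp only [Matrix.conjTranspose_mul, Matrix.conjTranspose_conjTranspose, Matrix.mul_assoc]
      rw [← Matrix.mul_assoc Uᴴ, hUU, Matrix.one_mul]
    have hpow : ∀ n : ℕ, (Aᴴ * A) ^ n = V * Matrix.diagonal (fun j => d j ^ n) * Vᴴ := by
      intro n
      induction n with
      | zero => simp [hVV']
      | succ n ih =>
        rw [pow_succ, ih, hAA]
        simp only [Matrix.mul_assoc]
        rw [← Matrix.mul_assoc Vᴴ V, hVV, Matrix.one_mul,
          ← Matrix.mul_assoc (Matrix.diagonal _) (Matrix.diagonal _), Matrix.diagonal_mul_diagonal]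
        simp only [pow_succ]
    have haev : Polynomial.aeval (Aᴴ * A) P =
        V * Matrix.diagonal (fun j => Polynomial.aeval (d j) P) * Vᴴ := by
      rw [Polynomial.aeval_eq_sum_range]
      simp only [hpow, Polynomial.aeval_eq_sum_range]
      have : Matrix.diagonal (fun j => ∑ i ∈ Finset.range (P.natDegree + 1), P.coeff i • d j ^ i) =
          ∑ i ∈ Finset.range (P.natDegree + 1),
            P.coeff i • Matrix.diagonal (fun j => d j ^ i) := by
        ext i j
        rw [Matrix.sum_apply]
        by_cases hij : i = j
        · subst hij; simp
        · simp [hij]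
      rw [this, Finset.mul_sum, Finset.sum_mul]
      simp
    rw [haev]
    conv_rhs => rw [e]
    simp only [Matrix.mul_assoc]
    rw [← Matrix.mul_assoc Vᴴ V, hVV, Matrix.one_mul, ← Matrix.mul_assoc (rectDiag 𝕜 M N σ)]
    congr 2
    ext i j
    rw [Matrix.mul_diagonal]
    simp only [rectDiag, Matrix.of_apply]
    split_ifs with hij
    · have hj : (j : ℕ) < M := hij ▸ i.2
      simp only [d, if_pos hj, hij, Function.comp_apply]
      rw [← hPs (σ j) (hn _) (hS _ hj)]
      have := Polynomial.aeval_algebraMap_apply 𝕜 (σ j ^ 2) P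
      rw [RCLike.algebraMap_eq_ofReal] at this
      rw [this]
      simp
    · simp
  have hm1 := main U σ V hU hV hn e fun j hj =>
    Finset.mem_union_left _ (Finset.mem_image_of_mem _ (Finset.mem_range.2 hj))
  have hm2 := main D.1 D.2.1 D.2.2 hU' hV' hn' e' fun j hj =>
    Finset.mem_union_right _ (Finset.mem_image_of_mem (fun j => D.2.1 j ^ 2) (Finset.mem_range.2 hj))
  rw [hm1, ← hm2]
  rfl

/-- The function `s_{τ,q}(σ) = max (min σ τ) (σ / q)`. -/
noncomputable def shrink (τ q : ℝ) (σ : ℝ) : ℝ := max (min σ τ) (σ / q)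

/-- The operator `𝔅_{F,τ,q}(W) = 𝔖_{s_{τ,q}}(q F + P_{Hᗮ} W)`. -/
noncomputable def fixMap (H : Submodule 𝕜 (Matrix (Fin M) (Fin N) 𝕜))
    (F : Matrix (Fin M) (Fin N) 𝕜) (τ q : ℝ) (W : Matrix (Fin M) (Fin N) 𝕜) :
    Matrix (Fin M) (Fin N) 𝕜 :=
  svCalc (shrink τ q) (q • F + Hᗮ.starProjection W)

/-- The functional `𝒦(A, B) = τ² rank A + p ‖A - B‖² + q ‖B - F‖²` (Frobenius norms). -/
noncomputable def objK (F : Matrix (Fin M) (Fin N) 𝕜) (τ p q : ℝ)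
    (A B : Matrix (Fin M) (Fin N) 𝕜) : ℝ :=
  τ ^ 2 * (A.rank : ℝ) + p * ‖A - B‖ ^ 2 + q * ‖B - F‖ ^ 2

/-- The Fenchel conjugate
`𝒦*(X, Y) = sup_{A, B} Re ⟪A, X⟫ + Re ⟪B, Y⟫ - 𝒦(A, B)`, with values in `[-∞, ∞]`. -/
noncomputable def conjK (F : Matrix (Fin M) (Fin N) 𝕜) (τ p q : ℝ)
    (X Y : Matrix (Fin M) (Fin N) 𝕜) : EReal :=
  ⨆ (A : Matrix (Fin M) (Fin N) 𝕜) (B : Matrix (Fin M) (Fin N) 𝕜),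
    ((RCLike.re (inner 𝕜 A X) + RCLike.re (inner 𝕜 B Y) - objK F τ p q A B : ℝ) : EReal)

end Definitions

end RankPenalty

/-! Write c = τ² rank and g(Z) = sup_A (2 Re⟪A, Z⟫ - ‖A‖² - c(A)), a finite convex function.
Completing the square in B shows that 𝒦*(X, Y) is g(Z) + ‖qF + Y/2‖² / (pq) up to a constant, where
Z = X/2 + F + Y/(2q) (`conjK_eq`). If X + Y ∈ Hᗮ, projecting qF + Y/2 onto H bounds this below by
g(Z) + ‖qF - P_H Z‖² / (q - 1), and the prescribed pair attains the bound with Z = W. The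
constrained problem thus reduces to minimizing this last functional over Z.

A minimizer W exists by coercivity and continuity. Its optimality condition says that W is the
proximal point of g at T = qF + P_{Hᗮ} W. By `subgradient_svCalc_shrink`, the shrinkage of T
satisfies the same condition, and proximal points are unique, so W is a fixed point.

The shrinkage claim reduces to scalars: g at U diag(s) Vᴴ is ∑ max(s_j² - τ², 0), and the scaled
residual of T is a convex combination of matrices attaining that supremum. The upper bound is
`minorant_rank_rectDiag_le`. -/

namespace RankPenalty

/-! ### Convex envelopes and proximal points in a real inner product space -/

section Envelope

variable {E : Type*} [NormedAddCommGroup E] [InnerProductSpace ℝ E]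

/-- The affine minorant `Z ↦ 2⟪A, Z⟫ - ‖A‖² - c A` of the envelope of a penalty `c`. -/
noncomputable def minorant (c : E → ℝ) (A Z : E) : ℝ := 2 * inner ℝ A Z - ‖A‖ ^ 2 - c A

/-- The supremum of all the affine minorants of a penalty `c`. -/
noncomputable def envelope (c : E → ℝ) (Z : E) : ℝ := ⨆ A, minorant c A Z

variable {c : E → ℝ}

theorem minorant_le_norm_sq (hc : ∀ A, 0 ≤ c A) (A Z : E) : minorant c A Z ≤ ‖Z‖ ^ 2 := by
  have h1 := norm_sub_sq_real A Z
  have h2 := sq_nonneg ‖A - Z‖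
  have h3 := hc A
  unfold minorant
  linarith

theorem minorant_le_envelope (hc : ∀ A, 0 ≤ c A) (A Z : E) : minorant c A Z ≤ envelope c Z :=
  le_ciSup (f := fun A => minorant c A Z)
    ⟨‖Z‖ ^ 2, by rintro _ ⟨A, rfl⟩; exact minorant_le_norm_sq hc A Z⟩ A

theorem envelope_le {Z : E} {r : ℝ} (h : ∀ A, minorant c A Z ≤ r) : envelope c Z ≤ r :=
  ciSup_le h

theorem minorant_add_smul (A X Y : E) {a b : ℝ} (hab : a + b = 1) :
    minorant c A (a • X + b • Y) = a * minorant c A X + b * minorant c A Y := by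
  obtain rfl : a = 1 - b := by linarith
  simp only [minorant, inner_add_right, inner_smul_right]
  ring

theorem convexOn_envelope (hc : ∀ A, 0 ≤ c A) : ConvexOn ℝ Set.univ (envelope c) := by
  refine ⟨convex_univ, fun X _ Y _ a b ha hb hab => envelope_le fun A => ?_⟩
  rw [minorant_add_smul A X Y hab]
  exact add_le_add (mul_le_mul_of_nonneg_left (minorant_le_envelope hc A X) ha)
    (mul_le_mul_of_nonneg_left (minorant_le_envelope hc A Y) hb)

theorem norm_sq_sub_le_envelope (hc : ∀ A, 0 ≤ c A) (Z : E) : ‖Z‖ ^ 2 - c Z ≤ envelope c Z := by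
  refine le_trans (le_of_eq ?_) (minorant_le_envelope hc Z Z)
  rw [minorant, real_inner_self_eq_norm_sq]
  ring

/-- A convex function with quadratic growth plus a quadratic fit attains its minimum. -/
theorem exists_minimizer [FiniteDimensional ℝ E] (hc : ∀ A, 0 ≤ c A) {C : ℝ} (hC : ∀ A, c A ≤ C)
    {κ : ℝ} (hκ : 0 ≤ κ) (Q : E) (P : E →ₗ[ℝ] E) :
    ∃ W, ∀ Z, envelope c W + κ * ‖Q - P W‖ ^ 2 ≤ envelope c Z + κ * ‖Q - P Z‖ ^ 2 := by
  have hcont : Continuous (envelope c) := by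
    rw [← continuousOn_univ]
    exact (convexOn_envelope hc).continuousOn isOpen_univ
  have hP : Continuous P := P.continuous_of_finiteDimensional
  refine Continuous.exists_forall_le (by fun_prop) ?_
  -- Coercivity: the minorant at A = Z already gives ‖Z‖² - c Z, and c is bounded by C.
  refine Filter.tendsto_atTop_mono (f := fun Z => ‖Z‖ ^ 2 - C) (fun Z => ?_) ?_
  · have := norm_sq_sub_le_envelope hc Z
    have := hC Z
    have : 0 ≤ κ * ‖Q - P Z‖ ^ 2 := by positivity
    linarith
  · exact Filter.tendsto_atTop_add_const_right _ _
      ((Filter.tendsto_pow_atTop two_ne_zero).comp (tendsto_norm_cocompact_atTop (E := E)))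

/-- The first-order optimality condition at a minimizer. -/
theorem subgradient_of_minimizer (hc : ∀ A, 0 ≤ c A) {κ : ℝ} {Q W : E} {P : E →ₗ[ℝ] E}
    (hP : ∀ x y, inner ℝ (P x) y = inner ℝ x (P y)) (hPP : ∀ x, P (P x) = P x) (hQ : P Q = Q)
    (hW : ∀ Z, envelope c W + κ * ‖Q - P W‖ ^ 2 ≤ envelope c Z + κ * ‖Q - P Z‖ ^ 2) (Z : E) :
    envelope c W + 2 * κ * inner ℝ (Q - P W) (Z - W) ≤ envelope c Z := by
  -- The residual is fixed by the symmetric idempotent P, so P can be dropped from the other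
  -- argument.
  have hin : inner ℝ (Q - P W) (P (Z - W)) = inner ℝ (Q - P W) (Z - W) := by
    rw [← hP, map_sub, hPP, hQ]
  set r := inner ℝ (Q - P W) (Z - W)
  -- Minimality is compared with convexity along the segment from W to Z. After division by t only
  -- the quadratic term keeps a factor t, and it vanishes as t → 0.
  have key : ∀ t : ℝ, 0 < t → t ≤ 1 →
      envelope c W + 2 * κ * r - envelope c Z ≤ t * (κ * ‖P (Z - W)‖ ^ 2) := by
    intro t ht ht1
    have h1 := hW ((1 - t) • W + t • Z)
    have h2 := (convexOn_envelope hc).2 (Set.mem_univ W) (Set.mem_univ Z) (sub_nonneg.2 ht1) ht.le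
      (by ring)
    have h3 : Q - P ((1 - t) • W + t • Z) = (Q - P W) - t • P (Z - W) := by
      simp only [map_add, map_smul, map_sub]
      module
    rw [h3, norm_sub_sq_real (Q - P W), inner_smul_right, hin, norm_smul, mul_pow, Real.norm_eq_abs,
      sq_abs] at h1
    simp only [smul_eq_mul] at h2
    have h4 : t * (envelope c W + 2 * κ * r - envelope c Z) ≤
        t * (t * (κ * ‖P (Z - W)‖ ^ 2)) := by linarith
    exact le_of_mul_le_mul_left h4 ht
  have hlim : Filter.Tendsto (fun t : ℝ => t * (κ * ‖P (Z - W)‖ ^ 2))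
      (nhdsWithin 0 (Set.Ioi 0)) (nhds 0) := by
    have : Continuous fun t : ℝ => t * (κ * ‖P (Z - W)‖ ^ 2) := by fun_prop
    simpa using (this.tendsto 0).mono_left nhdsWithin_le_nhds
  have := ge_of_tendsto hlim (Filter.mem_of_superset (Ioc_mem_nhdsGT one_pos)
    fun t ht => key t ht.1 ht.2)
  linarith

/-- Proximal points are unique. -/
theorem eq_of_subgradient {κ : ℝ} (hκ : 0 < κ) {φ : E → ℝ} {T S W : E}
    (hS : φ S + 2 * κ * inner ℝ (T - S) (W - S) ≤ φ W)
    (hW : φ W + 2 * κ * inner ℝ (T - W) (S - W) ≤ φ S) : S = W := by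
  have h : inner ℝ (T - S) (W - S) + inner ℝ (T - W) (S - W) = ‖S - W‖ ^ 2 := by
    rw [← real_inner_self_eq_norm_sq, ← neg_sub S W, inner_neg_right]
    simp only [inner_sub_left, inner_sub_right]
    ring
  have h2 : 2 * κ * ‖S - W‖ ^ 2 ≤ 0 := by rw [← h]; linarith
  have h3 : ‖S - W‖ ^ 2 ≤ 0 := by
    by_contra! h4
    have : 0 < 2 * κ * ‖S - W‖ ^ 2 := by positivity
    linarith
  have h4 : ‖S - W‖ = 0 := pow_eq_zero_iff two_ne_zero |>.1 (le_antisymm h3 (sq_nonneg _))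
  exact sub_eq_zero.1 (norm_eq_zero.1 h4)

/-- Completing the square in `B` in the functional whose supremum is the Fenchel conjugate. -/
theorem pairing_sub_objective (F A B X Y : E) {p q : ℝ} (hp : p ≠ 0) (hq : q ≠ 0)
    (hpq : p + q = p * q) :
    inner ℝ A X + inner ℝ B Y - (c A + p * ‖A - B‖ ^ 2 + q * ‖B - F‖ ^ 2) =
      minorant c A ((2 : ℝ)⁻¹ • X + F + (2 * q)⁻¹ • Y) +
        (p * q)⁻¹ * ‖q • F + (2 : ℝ)⁻¹ • Y‖ ^ 2 - q * ‖F‖ ^ 2 -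
        p * q * ‖B - (p * q)⁻¹ • (p • A + q • F + (2 : ℝ)⁻¹ • Y)‖ ^ 2 := by
  -- The relation p + q = pq excludes q = 1, so p can be eliminated and the identity becomes
  -- rational in q.
  have hq1 : q - 1 ≠ 0 := by
    intro h
    have : q = 1 := by linarith
    subst this
    linarith
  have hpe : p = q / (q - 1) := by rw [eq_div_iff hq1]; linarith
  simp only [minorant, ← real_inner_self_eq_norm_sq, inner_add_left, inner_add_right,
    inner_sub_left, inner_sub_right, inner_smul_left, inner_smul_right,
    real_inner_comm A, real_inner_comm F B, real_inner_comm Y F, real_inner_comm Y B,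
    RCLike.conj_to_real]
  rw [real_inner_comm B A, real_inner_comm F A, real_inner_comm Y A]
  subst hpe
  field_simp
  ring

end Envelope

/-! ### Frobenius geometry and the rank of rectangular diagonal matrices -/

section MatrixLemmas

variable {𝕜 : Type*} [RCLike 𝕜] {M N : ℕ}

/-- The real inner product `Re ⟪A, B⟫` on matrices. -/
noncomputable abbrev frobeniusRealInner : InnerProductSpace ℝ (Matrix (Fin M) (Fin N) 𝕜) where
  toNormedSpace := Matrix.frobeniusNormedSpace
  inner A B := RCLike.re (inner 𝕜 A B)
  norm_sq_eq_re_inner A := InnerProductSpace.norm_sq_eq_re_inner (𝕜 := 𝕜) A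
  conj_inner_symm A B := by simpa using inner_re_symm (𝕜 := 𝕜) B A
  add_left A B C := by simp only [inner_add_left, map_add]
  smul_left A B r := by
    have : r • A = (r : 𝕜) • A := by
      ext i j; simp [RCLike.real_smul_eq_coe_mul]
    rw [this, inner_smul_left (𝕜 := 𝕜), RCLike.conj_ofReal, RCLike.re_ofReal_mul]
    simp

theorem inner_eq_trace (A B : Matrix (Fin M) (Fin N) 𝕜) : inner 𝕜 A B = (Aᴴ * B).trace := by
  change ∑ i, ∑ j, inner 𝕜 (A i j) (B i j) = _
  rw [Finset.sum_comm]
  simp [Matrix.trace, Matrix.mul_apply, mul_comm]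

theorem inner_unitary_mul_mul {U : Matrix (Fin M) (Fin M) 𝕜} {V : Matrix (Fin N) (Fin N) 𝕜}
    (A B : Matrix (Fin M) (Fin N) 𝕜) :
    inner 𝕜 A (U * B * Vᴴ) = inner 𝕜 (Uᴴ * A * V) B := by
  simp only [inner_eq_trace, Matrix.conjTranspose_mul, Matrix.conjTranspose_conjTranspose]
  rw [← Matrix.mul_assoc, Matrix.trace_mul_comm]
  simp only [Matrix.mul_assoc]

theorem norm_unitary_mul_mul {U : Matrix (Fin M) (Fin M) 𝕜} {V : Matrix (Fin N) (Fin N) 𝕜}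
    (hU : U ∈ Matrix.unitaryGroup (Fin M) 𝕜) (hV : V ∈ Matrix.unitaryGroup (Fin N) 𝕜)
    (A : Matrix (Fin M) (Fin N) 𝕜) : ‖U * A * Vᴴ‖ = ‖A‖ := by
  have hUU : Uᴴ * U = 1 := (Matrix.mem_unitaryGroup_iff').1 hU
  have hVV : Vᴴ * V = 1 := (Matrix.mem_unitaryGroup_iff').1 hV
  have h : inner 𝕜 (U * A * Vᴴ) (U * A * Vᴴ) = inner 𝕜 A A := by
    rw [inner_unitary_mul_mul]
    congr 1
    simp only [Matrix.mul_assoc, hVV, Matrix.mul_one]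
    rw [← Matrix.mul_assoc, hUU, Matrix.one_mul]
  rw [← sq_eq_sq₀ (norm_nonneg _) (norm_nonneg _), InnerProductSpace.norm_sq_eq_re_inner (𝕜 := 𝕜),
    h, ← InnerProductSpace.norm_sq_eq_re_inner]

theorem inner_rectDiag (a b : ℕ → ℝ) :
    RCLike.re (inner 𝕜 (rectDiag 𝕜 M N a) (rectDiag 𝕜 M N b)) =
      ∑ j ∈ Finset.range N with j < M, a j * b j := by
  change RCLike.re (∑ i, ∑ j, inner 𝕜 (rectDiag 𝕜 M N a i j) (rectDiag 𝕜 M N b i j)) = _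
  rw [Finset.sum_comm, map_sum, Finset.sum_filter, Finset.sum_range]
  refine Finset.sum_congr rfl fun j _ => ?_
  by_cases hj : (j : ℕ) < M
  · rw [Finset.sum_eq_single ⟨j, hj⟩]
    · simp [rectDiag, hj, mul_comm]
    · intro k _ hk
      have : (k : ℕ) ≠ j := fun h => hk (Fin.ext h)
      simp [rectDiag, this]
    · simp
  · rw [Finset.sum_eq_zero]
    · simp [hj]
    · intro k _
      have : (k : ℕ) ≠ j := fun h => hj (h ▸ k.2)
      simp [rectDiag, this]

theorem norm_sq_rectDiag (a : ℕ → ℝ) :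
    ‖rectDiag 𝕜 M N a‖ ^ 2 = ∑ j ∈ Finset.range N with j < M, a j ^ 2 := by
  rw [InnerProductSpace.norm_sq_eq_re_inner (𝕜 := 𝕜), inner_rectDiag]
  simp only [sq]

/-- Right multiplication by the 0-1 mask `χ` of the nonzero entries changes nothing, so the rank of
the mask bounds the rank. One inequality suffices because the rank enters minorants with a minus
sign. -/
theorem rank_rectDiag_le (a : ℕ → ℝ) :
    ((rectDiag 𝕜 M N a).rank : ℝ) ≤
      ∑ j ∈ Finset.range N with j < M, if a j = 0 then (0 : ℝ) else 1 := by
  classical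
  let χ : Fin N → 𝕜 := fun j => if (j : ℕ) < M ∧ a j ≠ 0 then 1 else 0
  have h : rectDiag 𝕜 M N a = rectDiag 𝕜 M N a * Matrix.diagonal χ := by
    ext i j
    rw [Matrix.mul_diagonal]
    simp only [rectDiag, Matrix.of_apply, χ]
    by_cases hij : (i : ℕ) = j
    · have hj : (j : ℕ) < M := hij ▸ i.2
      by_cases ha : a j = 0 <;> simp [hij, hj, ha]
    · simp [hij]
  rw [h]
  refine (Nat.cast_le.2 (Matrix.rank_mul_le_right _ _)).trans ?_
  rw [Matrix.rank_diagonal, Fintype.card_subtype, Finset.card_filter, Finset.sum_filter,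
    Finset.sum_range]
  push_cast
  refine Finset.sum_le_sum fun j _ => ?_
  by_cases hj : (j : ℕ) < M <;> by_cases ha : a j = 0 <;> simp [χ, hj, ha]

/-- The trace of an orthogonal projection is its rank: expand in an orthonormal basis of R and
exchange the sums. -/
theorem sum_norm_sq_starProjection (R : Submodule 𝕜 (EuclideanSpace 𝕜 (Fin M))) :
    ∑ i, ‖R.starProjection (EuclideanSpace.single i 1)‖ ^ 2 = Module.finrank 𝕜 R := by
  let b := stdOrthonormalBasis 𝕜 R
  have h1 : ∀ i, ‖R.starProjection (EuclideanSpace.single i 1)‖ ^ 2 =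
      ∑ k, ‖(b k : EuclideanSpace 𝕜 (Fin M)) i‖ ^ 2 := by
    intro i
    rw [Submodule.starProjection_apply, Submodule.norm_coe, ← b.sum_sq_norm_inner_right]
    refine Finset.sum_congr rfl fun k _ => ?_
    rw [Submodule.inner_orthogonalProjectionOnto_eq_of_mem_left]
    simp [EuclideanSpace.inner_single_right]
  have h2 : ∀ k, ∑ i, ‖(b k : EuclideanSpace 𝕜 (Fin M)) i‖ ^ 2 = 1 := by
    intro k
    rw [← EuclideanSpace.norm_sq_eq, Submodule.norm_coe, b.orthonormal.1]
    simp
  simp only [h1]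
  rw [Finset.sum_comm]
  simp [h2]

/-- The columns of A lie in its range R, so column j contributes at most s_j² w_j, where w_j = ‖P_R
e_j‖². These weights lie in [0, 1] and sum to at most rank A. The resulting bound ∑ (s_j² - τ²) w_j
is linear in the weights, hence at most the sum of positive parts. No trace inequality for singular
values is needed. -/
theorem minorant_rank_rectDiag_le {τ : ℝ} (A : Matrix (Fin M) (Fin N) 𝕜) (s : ℕ → ℝ) :
    2 * RCLike.re (inner 𝕜 A (rectDiag 𝕜 M N s)) - ‖A‖ ^ 2 - τ ^ 2 * A.rank ≤
      ∑ j ∈ Finset.range N with j < M, max (s j ^ 2 - τ ^ 2) 0 := by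
  classical
  let R : Submodule 𝕜 (EuclideanSpace 𝕜 (Fin M)) := LinearMap.range (Matrix.toEuclideanLin A)
  have hR : Module.finrank 𝕜 R = A.rank := by
    rw [Matrix.rank_eq_finrank_range_toLin A (EuclideanSpace.basisFun (Fin M) 𝕜).toBasis
      (EuclideanSpace.basisFun (Fin N) 𝕜).toBasis, ← Matrix.toEuclideanLin_eq_toLin_orthonormal]
  let e : Fin M → EuclideanSpace 𝕜 (Fin M) := fun i => EuclideanSpace.single i 1
  let w : ℕ → ℝ := fun j => if h : j < M then ‖R.starProjection (e ⟨j, h⟩)‖ ^ 2 else 0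
  have hw0 : ∀ j, 0 ≤ w j := fun j => by simp only [w]; split_ifs <;> positivity
  have hw1 : ∀ j, w j ≤ 1 := fun j => by
    simp only [w]
    split_ifs with h
    · have h1 := R.norm_starProjection_apply_le (e ⟨j, h⟩)
      have h2 : ‖e ⟨j, h⟩‖ = 1 := by simp [e]
      rw [h2] at h1
      exact pow_le_one₀ (norm_nonneg _) h1
    · exact zero_le_one
  have hwsum : ∑ j ∈ Finset.range N with j < M, w j ≤ A.rank := by
    rw [← hR, ← sum_norm_sq_starProjection R]
    have : ∑ j ∈ Finset.range M, w j = ∑ i, ‖R.starProjection (e i)‖ ^ 2 := by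
      rw [Finset.sum_range]
      simp [w]
    rw [← this]
    refine Finset.sum_le_sum_of_subset_of_nonneg (fun j hj => ?_) fun j _ _ => hw0 j
    exact Finset.mem_range.2 (Finset.mem_filter.1 hj).2
  let col : Fin N → EuclideanSpace 𝕜 (Fin M) := fun j => WithLp.toLp 2 fun i => A i j
  have hcol : ∀ j, col j ∈ R := fun j => by
    refine ⟨EuclideanSpace.single j 1, ?_⟩
    ext i
    simp [col]
  have hnorm : ‖A‖ ^ 2 = ∑ j, ‖col j‖ ^ 2 := by
    rw [InnerProductSpace.norm_sq_eq_re_inner (𝕜 := 𝕜)]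
    change RCLike.re (∑ i, ∑ j, inner 𝕜 (A i j) (A i j)) = _
    rw [Finset.sum_comm]
    simp [col, EuclideanSpace.norm_sq_eq]
  have hinner : RCLike.re (inner 𝕜 A (rectDiag 𝕜 M N s)) =
      ∑ j : Fin N, if h : (j : ℕ) < M then s j * RCLike.re (inner 𝕜 (col j) (e ⟨j, h⟩)) else 0 := by
    change RCLike.re (∑ i, ∑ j, inner 𝕜 (A i j) (rectDiag 𝕜 M N s i j)) = _
    rw [Finset.sum_comm, map_sum]
    refine Finset.sum_congr rfl fun j _ => ?_
    by_cases hj : (j : ℕ) < M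
    · rw [Finset.sum_eq_single ⟨j, hj⟩]
      · simp [rectDiag, hj, e, col, EuclideanSpace.inner_single_right]
      · intro k _ hk
        have : (k : ℕ) ≠ j := fun h => hk (Fin.ext h)
        simp [rectDiag, this]
      · simp
    · rw [Finset.sum_eq_zero]
      · simp [hj]
      · intro k _
        have : (k : ℕ) ≠ j := fun h => hj (h ▸ k.2)
        simp [rectDiag, this]
  have hle : 2 * RCLike.re (inner 𝕜 A (rectDiag 𝕜 M N s)) - ‖A‖ ^ 2 ≤
      ∑ j ∈ Finset.range N with j < M, s j ^ 2 * w j := by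
    rw [hinner, hnorm, Finset.sum_filter, Finset.sum_range, Finset.mul_sum,
      ← Finset.sum_sub_distrib]
    refine Finset.sum_le_sum fun j _ => ?_
    by_cases hj : (j : ℕ) < M
    · simp only [hj, dif_pos, if_true, w]
      -- As column j lies in R, e_j may be replaced by its projection; then ‖col j - s_j P_R e_j‖² ≥
      -- 0 gives the bound.
      rw [← Submodule.starProjection_eq_self_iff.2 (hcol j),
        R.inner_starProjection_left_eq_right, Submodule.starProjection_eq_self_iff.2 (hcol j)]
      have h1 := re_inner_le_norm (𝕜 := 𝕜) (col j) (R.starProjection (e ⟨j, hj⟩))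
      have h2 := norm_sub_sq (𝕜 := 𝕜) (col j) ((s j : 𝕜) • R.starProjection (e ⟨j, hj⟩))
      rw [inner_smul_right, RCLike.re_ofReal_mul, norm_smul, mul_pow, RCLike.norm_ofReal,
        sq_abs] at h2
      have h3 := sq_nonneg ‖col j - (s j : 𝕜) • R.starProjection (e ⟨j, hj⟩)‖
      change 2 * (s j * RCLike.re (inner 𝕜 (col j) (R.starProjection (e ⟨j, hj⟩)))) - _ ≤ _
      linarith
    · simp [hj]
  calc _ ≤ (∑ j ∈ Finset.range N with j < M, s j ^ 2 * w j) -
        τ ^ 2 * ∑ j ∈ Finset.range N with j < M, w j :=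
        sub_le_sub hle (mul_le_mul_of_nonneg_left hwsum (sq_nonneg τ))
    _ = ∑ j ∈ Finset.range N with j < M, (s j ^ 2 - τ ^ 2) * w j := by
        rw [Finset.mul_sum, ← Finset.sum_sub_distrib]
        simp only [sub_mul]
    _ ≤ _ := Finset.sum_le_sum fun j _ => by
        refine (mul_le_mul_of_nonneg_right (le_max_left _ 0) (hw0 j)).trans ?_
        exact mul_le_of_le_one_right (le_max_right _ _) (hw1 j)

end MatrixLemmas

/-! ### Subgradients of the envelope at a shrunken matrix -/

section Subgradient

variable {𝕜 : Type*} [RCLike 𝕜] {M N : ℕ}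

/-- Linearity makes the half-space of diagonals in `subgradient_svCalc_shrink` convex. -/
theorem isLinearMap_inner_rectDiag (Y : Matrix (Fin M) (Fin N) 𝕜) :
    IsLinearMap ℝ fun a : Fin M → ℝ => RCLike.re (inner 𝕜
      (rectDiag 𝕜 M N fun k => if h : k < M then a ⟨k, h⟩ else 0) Y) := by
  let := frobeniusRealInner (𝕜 := 𝕜) (M := M) (N := N)
  constructor
  · intro a b
    rw [← map_add, ← inner_add_left]
    congr 2
    ext i j
    by_cases h : (i : ℕ) = j <;> simp [rectDiag, h]
  · intro r a
    rw [smul_eq_mul, ← RCLike.re_ofReal_mul, ← RCLike.conj_ofReal, ← inner_smul_left]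
    congr 2
    ext i j
    by_cases h : (i : ℕ) = j <;> simp [rectDiag, h]

theorem shrink_zero {τ q : ℝ} (hτ : 0 < τ) : shrink τ q 0 = 0 := by simp [shrink, hτ.le]

/-- The scaled residual of `shrink` is a convex combination of the maximizers of
`a ↦ 2 * a * s - a² - τ² * [a ≠ 0]`, where `s = shrink τ q t`. -/
theorem residual_shrink_mem_convexHull {τ q t : ℝ} (hτ : 0 < τ) (hq : 1 < q) (ht : 0 ≤ t) :
    (q - 1)⁻¹ * (t - shrink τ q t) ∈ convexHull ℝ {a : ℝ | max (shrink τ q t ^ 2 - τ ^ 2) 0 ≤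
      2 * (a * shrink τ q t) - a ^ 2 - τ ^ 2 * (if a = 0 then 0 else 1)} := by
  have hq0 : 0 < q := by linarith
  have hq1 : 0 < q - 1 := by linarith
  -- For t ≤ τ the residual is 0, a maximizer. For τ ≤ t ≤ qτ both 0 and τ are maximizers and the
  -- scaled residual lies between them. For t ≥ qτ it equals t / q, which is again a maximizer.
  rcases le_total t τ with h1 | h1
  · have hs : shrink τ q t = t := by
      rw [shrink, min_eq_left h1, max_eq_left]
      exact div_le_self ht hq.le
    rw [hs]
    refine subset_convexHull ℝ _ ?_
    have : t ^ 2 ≤ τ ^ 2 := pow_le_pow_left₀ ht h1 2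
    simp [this]
  rcases le_total t (q * τ) with h2 | h2
  · have hs : shrink τ q t = τ := by
      rw [shrink, min_eq_right h1, max_eq_left]
      rwa [div_le_iff₀' hq0]
    rw [hs]
    have h0 : (0 : ℝ) ∈ {a : ℝ | max (τ ^ 2 - τ ^ 2) 0 ≤
      2 * (a * τ) - a ^ 2 - τ ^ 2 * (if a = 0 then 0 else 1)} := by simp
    have hτm : τ ∈ {a : ℝ | max (τ ^ 2 - τ ^ 2) 0 ≤
        2 * (a * τ) - a ^ 2 - τ ^ 2 * (if a = 0 then 0 else 1)} := by
      simp only [Set.mem_ofPred_eq, sub_self, max_self, if_neg hτ.ne']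
      nlinarith
    refine segment_subset_convexHull h0 hτm ?_
    rw [segment_eq_Icc hτ.le]
    refine ⟨mul_nonneg (inv_nonneg.2 hq1.le) (by linarith), ?_⟩
    rw [inv_mul_le_iff₀ hq1]
    linarith
  · have hs : shrink τ q t = t / q := by
      rw [shrink, min_eq_right h1, max_eq_right]
      rwa [le_div_iff₀' hq0]
    have hst : (q - 1)⁻¹ * (t - t / q) = t / q := by field_simp
    have hτs : τ ≤ t / q := by rwa [le_div_iff₀' hq0]
    have hs0 : t / q ≠ 0 := (hτ.trans_le hτs).ne'
    rw [hs, hst]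
    refine subset_convexHull ℝ _ ?_
    have : τ ^ 2 ≤ (t / q) ^ 2 := pow_le_pow_left₀ hτ.le hτs 2
    simp only [Set.mem_ofPred_eq, if_neg hs0]
    rw [max_eq_left (by linarith)]
    exact le_of_eq (by ring)

variable {U : Matrix (Fin M) (Fin M) 𝕜} {V : Matrix (Fin N) (Fin N) 𝕜} {τ : ℝ}

theorem minorant_rank_le_sum (hU : U ∈ Matrix.unitaryGroup (Fin M) 𝕜)
    (hV : V ∈ Matrix.unitaryGroup (Fin N) 𝕜) (A : Matrix (Fin M) (Fin N) 𝕜) (s : ℕ → ℝ) :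
    2 * RCLike.re (inner 𝕜 A (U * rectDiag 𝕜 M N s * Vᴴ)) - ‖A‖ ^ 2 - τ ^ 2 * A.rank ≤
      ∑ j ∈ Finset.range N with j < M, max (s j ^ 2 - τ ^ 2) 0 := by
  refine le_trans ?_ (minorant_rank_rectDiag_le (τ := τ) (Uᴴ * A * V) s)
  have h1 : ‖Uᴴ * A * V‖ = ‖A‖ := by
    have := norm_unitary_mul_mul (Unitary.star_mem hU) (Unitary.star_mem hV) A
    rwa [Matrix.star_eq_conjTranspose, Matrix.star_eq_conjTranspose,
      Matrix.conjTranspose_conjTranspose] at this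
  have h2 : ((Uᴴ * A * V).rank : ℝ) ≤ A.rank := Nat.cast_le.2
    ((Matrix.rank_mul_le_left _ _).trans (Matrix.rank_mul_le_right _ _))
  rw [inner_unitary_mul_mul, h1]
  exact sub_le_sub_left (mul_le_mul_of_nonneg_left h2 (sq_nonneg τ)) _

/-- Entrywise maximizers assemble into a matrix whose minorant attains the upper bound of
`minorant_rank_le_sum`, hence supports the envelope there. -/
theorem sum_le_minorant_rank (hU : U ∈ Matrix.unitaryGroup (Fin M) 𝕜)
    (hV : V ∈ Matrix.unitaryGroup (Fin N) 𝕜) {a s : ℕ → ℝ}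
    (ha : ∀ j < M, max (s j ^ 2 - τ ^ 2) 0 ≤
      2 * (a j * s j) - a j ^ 2 - τ ^ 2 * (if a j = 0 then 0 else 1)) :
    ∑ j ∈ Finset.range N with j < M, max (s j ^ 2 - τ ^ 2) 0 ≤
      2 * RCLike.re (inner 𝕜 (U * rectDiag 𝕜 M N a * Vᴴ) (U * rectDiag 𝕜 M N s * Vᴴ)) -
        ‖U * rectDiag 𝕜 M N a * Vᴴ‖ ^ 2 - τ ^ 2 * (U * rectDiag 𝕜 M N a * Vᴴ).rank := by
  have hUU : Uᴴ * U = 1 := (Matrix.mem_unitaryGroup_iff').1 hU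
  have hVV : Vᴴ * V = 1 := (Matrix.mem_unitaryGroup_iff').1 hV
  have h1 : Uᴴ * (U * rectDiag 𝕜 M N a * Vᴴ) * V = rectDiag 𝕜 M N a := by
    simp only [Matrix.mul_assoc, hVV, Matrix.mul_one]
    rw [← Matrix.mul_assoc, hUU, Matrix.one_mul]
  have h2 : ((U * rectDiag 𝕜 M N a * Vᴴ).rank : ℝ) ≤
      ∑ j ∈ Finset.range N with j < M, if a j = 0 then (0 : ℝ) else 1 :=
    (Nat.cast_le.2 ((Matrix.rank_mul_le_left _ _).trans (Matrix.rank_mul_le_right _ _))).trans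
      (rank_rectDiag_le (𝕜 := 𝕜) a)
  rw [inner_unitary_mul_mul, h1, norm_unitary_mul_mul hU hV, inner_rectDiag, norm_sq_rectDiag]
  refine le_trans (Finset.sum_le_sum fun j hj => ha j (Finset.mem_filter.1 hj).2) ?_
  rw [Finset.sum_sub_distrib, Finset.sum_sub_distrib, ← Finset.mul_sum, ← Finset.mul_sum]
  exact sub_le_sub_left (mul_le_mul_of_nonneg_left h2 (sq_nonneg τ)) _

attribute [local instance 2000] frobeniusRealInner

/-- `svCalc (shrink τ q) T` satisfies the optimality condition of the proximal map of the
envelope of the rank penalty. -/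
theorem subgradient_svCalc_shrink {q : ℝ} (hτ : 0 < τ) (hq : 1 < q)
    (T Z : Matrix (Fin M) (Fin N) 𝕜) :
    envelope (fun A => τ ^ 2 * (A.rank : ℝ)) (svCalc (shrink τ q) T) +
      2 * (q - 1)⁻¹ * RCLike.re
        (inner 𝕜 (T - svCalc (shrink τ q) T) (Z - svCalc (shrink τ q) T)) ≤
      envelope (fun A => τ ^ 2 * (A.rank : ℝ)) Z := by
  obtain ⟨⟨U, t, V⟩, hT⟩ := exists_isSVD T
  have hU : U ∈ Matrix.unitaryGroup (Fin M) 𝕜 := hT.left_unitary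
  have hV : V ∈ Matrix.unitaryGroup (Fin N) 𝕜 := hT.right_unitary
  have hT' : T = U * rectDiag 𝕜 M N t * Vᴴ := hT.eq
  have ht : ∀ j, 0 ≤ t j := hT.nonneg
  rw [svCalc_eq (shrink_zero hτ) hT]
  set s : ℕ → ℝ := shrink τ q ∘ t with hs
  change envelope _ (U * rectDiag 𝕜 M N s * Vᴴ) + 2 * (q - 1)⁻¹ * RCLike.re
    (inner 𝕜 (T - U * rectDiag 𝕜 M N s * Vᴴ) (Z - U * rectDiag 𝕜 M N s * Vᴴ)) ≤ _
  set S := U * rectDiag 𝕜 M N s * Vᴴ with hS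
  set c : Matrix (Fin M) (Fin N) 𝕜 → ℝ := fun A => τ ^ 2 * (A.rank : ℝ) with hc
  have hc0 : ∀ A, 0 ≤ c A := fun A => by positivity
  have henv : envelope c S ≤ ∑ j ∈ Finset.range N with j < M, max (s j ^ 2 - τ ^ 2) 0 :=
    envelope_le fun A => minorant_rank_le_sum hU hV A s
  let ext : (Fin M → ℝ) → ℕ → ℝ := fun a k => if h : k < M then a ⟨k, h⟩ else 0
  let vert : Fin M → Set ℝ := fun j => {a : ℝ | max (s j ^ 2 - τ ^ 2) 0 ≤
    2 * (a * s j) - a ^ 2 - τ ^ 2 * (if a = 0 then 0 else 1)}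
  have hmove : ∀ a, RCLike.re (inner 𝕜 (U * rectDiag 𝕜 M N a * Vᴴ) (Z - S)) =
      RCLike.re (inner 𝕜 (rectDiag 𝕜 M N a) (Uᴴ * (Z - S) * V)) := by
    intro a
    rw [inner_re_symm, inner_unitary_mul_mul, inner_re_symm]
  -- For a tuple of maximizers the minorant touches the envelope at S, so its slope is a subgradient
  -- there.
  have hvert : Set.univ.pi vert ⊆ {a | RCLike.re
      (inner 𝕜 (rectDiag 𝕜 M N (ext a)) (Uᴴ * (Z - S) * V)) ≤
      (envelope c Z - envelope c S) / 2} := by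
    intro a ha
    have h1 := sum_le_minorant_rank (τ := τ) (a := ext a) (s := s) hU hV fun j hj => by
      simpa [ext, hj, vert] using ha ⟨j, hj⟩ trivial
    have h2 := minorant_le_envelope hc0 (U * rectDiag 𝕜 M N (ext a) * Vᴴ) Z
    have h3 := hmove (ext a)
    rw [inner_sub_right, map_sub] at h3
    change 2 * RCLike.re (inner 𝕜 _ Z) - _ - _ ≤ _ at h2
    rw [← hS] at h1
    simp only [Set.mem_ofPred_eq, ← h3]
    simp only [hc] at h2 henv ⊢
    linarith
  -- The half-space contains the hull of the product of the vertex sets, which contains every tuple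
  -- of points of the individual hulls, in particular the scaled residual.
  have hg := convexHull_min hvert (convex_halfSpace_le (isLinearMap_inner_rectDiag _) _)
    (mem_convexHull_pi (x := fun j : Fin M => (q - 1)⁻¹ * (t j - s j)) fun j _ =>
      residual_shrink_mem_convexHull hτ hq (ht j))
  have hTS : (q - 1)⁻¹ • (T - S) =
      U * rectDiag 𝕜 M N (ext fun j => (q - 1)⁻¹ * (t j - s j)) * Vᴴ := by
    rw [hT', hS, ← Matrix.sub_mul, ← Matrix.mul_sub, ← Matrix.smul_mul, ← Matrix.mul_smul]
    congr 2
    ext i j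
    by_cases h : (i : ℕ) = j
    · have hj : (j : ℕ) < M := h ▸ i.2
      simp [rectDiag, ext, h, RCLike.real_smul_eq_coe_mul]
    · simp [rectDiag, h]
  have hsm : (q - 1)⁻¹ * RCLike.re (inner 𝕜 (T - S) (Z - S)) =
      RCLike.re (inner 𝕜 ((q - 1)⁻¹ • (T - S)) (Z - S)) :=
    (real_inner_smul_left (T - S) (Z - S) (q - 1)⁻¹).symm
  rw [Set.mem_ofPred_eq, ← hmove, ← hTS, ← hsm] at hg
  linarith

end Subgradient

/-! ### The Fenchel conjugate and the fixed point -/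

section Conjugate

variable {𝕜 : Type*} [RCLike 𝕜] {M N : ℕ}

attribute [local instance 2000] frobeniusRealInner

theorem pairing_sub_objK (F A B X Y : Matrix (Fin M) (Fin N) 𝕜) {τ p q : ℝ} (hp : p ≠ 0)
    (hq : q ≠ 0) (hpq : p + q = p * q) :
    RCLike.re (inner 𝕜 A X) + RCLike.re (inner 𝕜 B Y) - objK F τ p q A B =
      minorant (fun A => τ ^ 2 * (A.rank : ℝ)) A ((2 : ℝ)⁻¹ • X + F + (2 * q)⁻¹ • Y) +
        (p * q)⁻¹ * ‖q • F + (2 : ℝ)⁻¹ • Y‖ ^ 2 - q * ‖F‖ ^ 2 -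
        p * q * ‖B - (p * q)⁻¹ • (p • A + q • F + (2 : ℝ)⁻¹ • Y)‖ ^ 2 :=
  pairing_sub_objective (c := fun A => τ ^ 2 * (A.rank : ℝ)) F A B X Y hp hq hpq

/-- The Fenchel conjugate in terms of the envelope of the rank penalty. -/
theorem conjK_eq (F X Y : Matrix (Fin M) (Fin N) 𝕜) {τ p q : ℝ} (hp : 0 < p)
    (hq : 0 < q) (hpq : p + q = p * q) :
    conjK F τ p q X Y =
      ((envelope (fun A => τ ^ 2 * (A.rank : ℝ)) ((2 : ℝ)⁻¹ • X + F + (2 * q)⁻¹ • Y) +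
        (p * q)⁻¹ * ‖q • F + (2 : ℝ)⁻¹ • Y‖ ^ 2 - q * ‖F‖ ^ 2 : ℝ) : EReal) := by
  have hc0 : ∀ A : Matrix (Fin M) (Fin N) 𝕜, 0 ≤ τ ^ 2 * (A.rank : ℝ) := fun A => by positivity
  apply le_antisymm
  · refine iSup₂_le fun A B => EReal.coe_le_coe_iff.2 ?_
    rw [pairing_sub_objK F A B X Y hp.ne' hq.ne' hpq]
    have h1 := minorant_le_envelope hc0 A ((2 : ℝ)⁻¹ • X + F + (2 * q)⁻¹ • Y)
    have h2 : 0 ≤ p * q * ‖B - (p * q)⁻¹ • (p • A + q • F + (2 : ℝ)⁻¹ • Y)‖ ^ 2 := by positivity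
    linarith
  · have hA : ∀ A, ((minorant (fun A => τ ^ 2 * (A.rank : ℝ)) A
        ((2 : ℝ)⁻¹ • X + F + (2 * q)⁻¹ • Y) +
        (p * q)⁻¹ * ‖q • F + (2 : ℝ)⁻¹ • Y‖ ^ 2 - q * ‖F‖ ^ 2 : ℝ) : EReal) ≤
        conjK F τ p q X Y := by
      intro A
      refine le_trans (le_of_eq ?_)
        -- This B makes the completed square vanish.
        (le_iSup₂ A ((p * q)⁻¹ • (p • A + q • F + (2 : ℝ)⁻¹ • Y)))
      rw [pairing_sub_objK F A _ X Y hp.ne' hq.ne' hpq]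
      simp
    induction h : conjK F τ p q X Y with
    | bot => exact absurd (le_bot_iff.1 (h ▸ hA 0)) (EReal.coe_ne_bot _)
    | top => exact le_top
    | coe r =>
      rw [EReal.coe_le_coe_iff]
      have : envelope (fun A => τ ^ 2 * (A.rank : ℝ)) ((2 : ℝ)⁻¹ • X + F + (2 * q)⁻¹ • Y) ≤
          r - (p * q)⁻¹ * ‖q • F + (2 : ℝ)⁻¹ • Y‖ ^ 2 + q * ‖F‖ ^ 2 := by
        refine envelope_le fun A => ?_
        have := EReal.coe_le_coe_iff.1 (h ▸ hA A)
        linarith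
      linarith

theorem real_smul_eq_coe_smul (r : ℝ) (A : Matrix (Fin M) (Fin N) 𝕜) : r • A = (r : 𝕜) • A := by
  ext i j
  simp [RCLike.real_smul_eq_coe_mul]

/-- Orthogonal projection onto `H` as a real linear map. -/
noncomputable def realProjection (H : Submodule 𝕜 (Matrix (Fin M) (Fin N) 𝕜)) :
    Matrix (Fin M) (Fin N) 𝕜 →ₗ[ℝ] Matrix (Fin M) (Fin N) 𝕜 where
  toFun := H.starProjection
  map_add' := map_add _
  map_smul' r A := by
    rw [real_smul_eq_coe_smul, map_smul, RingHom.id_apply, real_smul_eq_coe_smul]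

theorem realProjection_apply (H : Submodule 𝕜 (Matrix (Fin M) (Fin N) 𝕜))
    (A : Matrix (Fin M) (Fin N) 𝕜) : realProjection H A = H.starProjection A := rfl

/-- A minimizer and the shrinkage of T = qF + P_{Hᗮ} W are both proximal points of the envelope at
T, hence equal. -/
theorem exists_fixedPoint_minimizer {H : Submodule 𝕜 (Matrix (Fin M) (Fin N) 𝕜)}
    {F : Matrix (Fin M) (Fin N) 𝕜} (hF : F ∈ H) {τ q : ℝ} (hτ : 0 < τ) (hq : 1 < q) :
    ∃ W, fixMap H F τ q W = W ∧ ∀ Z,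
      envelope (fun A => τ ^ 2 * (A.rank : ℝ)) W +
          (q - 1)⁻¹ * ‖q • F - H.starProjection W‖ ^ 2 ≤
        envelope (fun A => τ ^ 2 * (A.rank : ℝ)) Z +
          (q - 1)⁻¹ * ‖q • F - H.starProjection Z‖ ^ 2 := by
  have hκ : 0 < (q - 1)⁻¹ := inv_pos.2 (by linarith)
  have hc0 : ∀ A : Matrix (Fin M) (Fin N) 𝕜, 0 ≤ τ ^ 2 * (A.rank : ℝ) := fun A => by positivity
  have hcM : ∀ A : Matrix (Fin M) (Fin N) 𝕜, τ ^ 2 * (A.rank : ℝ) ≤ τ ^ 2 * M := fun A => by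
    have : A.rank ≤ M := A.rank_le_height
    gcongr
  have hqF : q • F ∈ H := by
    rw [real_smul_eq_coe_smul]
    exact H.smul_mem _ hF
  have hsymm : ∀ x y, inner ℝ (realProjection H x) y = inner ℝ x (realProjection H y) :=
    fun x y => congrArg RCLike.re (H.inner_starProjection_left_eq_right x y)
  have hidem : ∀ x, realProjection H (realProjection H x) = realProjection H x := fun x => by
    rw [realProjection_apply, realProjection_apply]
    exact Submodule.starProjection_eq_self_iff.2 (H.starProjection_apply_mem x)
  have hfix : realProjection H (q • F) = q • F := by
    rw [realProjection_apply]
    exact Submodule.starProjection_eq_self_iff.2 hqF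
  have : FiniteDimensional ℝ (Matrix (Fin M) (Fin N) 𝕜) := Module.Finite.matrix
  obtain ⟨W, hW⟩ := exists_minimizer hc0 hcM hκ.le (q • F) (realProjection H)
  have hsub := subgradient_of_minimizer hc0 hsymm hidem hfix hW
  simp only [realProjection_apply] at hW hsub
  refine ⟨W, ?_, hW⟩
  -- The residual T - W is exactly the gradient direction of the quadratic term, which turns
  -- optimality into the proximal condition at T.
  have hT : q • F + Hᗮ.starProjection W - W = q • F - H.starProjection W := by
    rw [Submodule.starProjection_orthogonal_val]
    abel
  refine eq_of_subgradient (T := q • F + Hᗮ.starProjection W) hκ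
    (subgradient_svCalc_shrink hτ hq _ W) ?_
  rw [hT]
  exact hsub _

end Conjugate

end RankPenalty

/-! ### Reduction of the constrained dual problem to the minimization over Z -/

theorem theorem4p2 {𝕜 : Type*} [RCLike 𝕜] (M N : ℕ)
    (H : Submodule 𝕜 (Matrix (Fin M) (Fin N) 𝕜)) (F : Matrix (Fin M) (Fin N) 𝕜) (hF : F ∈ H)
    (τ p q : ℝ) (hτ : 0 < τ) (hp : 1 < p) (hq : 1 < q) (hpq : 1 / p + 1 / q = 1) :
    ∃ W X Y : Matrix (Fin M) (Fin N) 𝕜,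
      RankPenalty.fixMap H F τ q W = W ∧
      X = (2 * p) • (H.starProjection W - F) + (2 : ℝ) • Hᗮ.starProjection W ∧
      Y = -((2 * p) • (H.starProjection W - F)) ∧
      X + Y ∈ Hᗮ ∧
      ∀ X' Y' : Matrix (Fin M) (Fin N) 𝕜, X' + Y' ∈ Hᗮ →
        RankPenalty.conjK F τ p q X Y ≤ RankPenalty.conjK F τ p q X' Y' := by
  have hp0 : 0 < p := by linarith
  have hq0 : 0 < q := by linarith
  have hq1 : 0 < q - 1 := by linarith
  have hpq' : p + q = p * q := by
    field_simp at hpq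
    linarith
  have hpe : p = q / (q - 1) := by rw [eq_div_iff hq1.ne']; linarith
  have hκ : (p * q)⁻¹ * p ^ 2 = (q - 1)⁻¹ := by
    subst hpe
    field_simp
  have hnorm : ∀ A : Matrix (Fin M) (Fin N) 𝕜,
      (p * q)⁻¹ * ‖p • A‖ ^ 2 = (q - 1)⁻¹ * ‖A‖ ^ 2 := fun A => by
    rw [norm_smul, mul_pow, Real.norm_eq_abs, sq_abs, ← mul_assoc, hκ]
  obtain ⟨W, hfix, hmin⟩ := RankPenalty.exists_fixedPoint_minimizer hF hτ hq
  refine ⟨W, _, _, hfix, rfl, rfl, ?_, fun X' Y' h => ?_⟩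
  · rw [add_neg_cancel_comm, RankPenalty.real_smul_eq_coe_smul]
    exact Hᗮ.smul_mem _ (Hᗮ.starProjection_apply_mem W)
  rw [RankPenalty.conjK_eq F _ _ hp0 hq0 hpq', RankPenalty.conjK_eq F _ _ hp0 hq0 hpq',
    EReal.coe_le_coe_iff]
  have hW : (2 : ℝ)⁻¹ • ((2 * p) • (H.starProjection W - F) + (2 : ℝ) • Hᗮ.starProjection W) + F +
      (2 * q)⁻¹ • -((2 * p) • (H.starProjection W - F)) = W := by
    rw [Submodule.starProjection_orthogonal_val, hpe]
    match_scalars <;> field_simp <;> ring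
  -- For the prescribed pair the quadratic argument already lies in H, so projecting it loses
  -- nothing.
  have hFW : q • F + (2 : ℝ)⁻¹ • -((2 * p) • (H.starProjection W - F)) =
      p • (q • F - H.starProjection W) := by
    rw [hpe]
    match_scalars <;> field_simp
    ring
  set Z := (2 : ℝ)⁻¹ • X' + F + (2 * q)⁻¹ • Y' with hZ
  have hFZ : q • F + (2 : ℝ)⁻¹ • Y' = p • (q • F - Z + (2 : ℝ)⁻¹ • (X' + Y')) := by
    rw [hZ, hpe]
    match_scalars <;> field_simp <;> ring
  -- The constraint enters here: the projection onto H annihilates X' + Y'.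
  have hproj : H.starProjection (q • F - Z + (2 : ℝ)⁻¹ • (X' + Y')) =
      q • F - H.starProjection Z := by
    simp only [RankPenalty.real_smul_eq_coe_smul, map_add, map_sub, map_smul]
    rw [← map_add, H.starProjection_apply_eq_zero_iff.2 h,
      Submodule.starProjection_eq_self_iff.2 hF, smul_zero, add_zero]
  rw [hW, hFW, hFZ, hnorm, hnorm]
  refine sub_le_sub_right ((hmin Z).trans (add_le_add_right (mul_le_mul_of_nonneg_left
    (pow_le_pow_left₀ (norm_nonneg _) ?_ 2) (inv_pos.2 hq1).le) _)) _
  rw [← hproj]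
  exact H.norm_starProjection_apply_le _
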